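/- Let $p$ be a prime number and let $A$ be a discrete valuation ring (not necessarily complete) with maximal ideal $\mathfrak p_A$, whose residue field has characteristic $p$. All rings are commutative with $1$. An $\mathbb F_p$-algebra $R$ is called perfect if the endomorphism $x\mapsto x^p$ of $R$ is bijective. Let $\mathrm{CRP}_A$ be the full subcategory of the category of $A$-algebras consisting of those $B$ that are flat over $A$, complete and separated with respect to the ideal $\mathfrak p_A B$, and such that $\overline{B}:=B/\mathfrak p_A B$ is perfect. For an $\mathbb F_p$-algebra $S$, let $\mathrm{PerfAlg}_S$ be the full subcategory of the category of $S$-algebras consisting of the perfect ones. Then $\mathrm{CRP}_A$ has an initial object $A^{\mathrm u}$, and the functor \[ \mathrm{CRP}_A\to \mathrm{PerfAlg}_{\overline{A^{\mathrm u}}},\qquad B\mapsto \overline{B}, \] where $\overline{B}$ is an $\overline{A^{\mathrm u}}$-algebra via the reduction of the unique morphism $A^{\mathrm u}\to B$, is an equivalence of categories. -/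

import Mathlib

open CategoryTheory

universe u

namespace ResidualPerfection

/-- `R` is a perfect `𝔽_p`-algebra: `p = 0` in `R`, and the Frobenius endomorphism `x ↦ x ^ p`
is bijective. (The zero ring is one.) -/
structure IsPerfectAlg (p : ℕ) (R : Type u) [CommRing R] : Prop where
  cast_eq_zero : (p : R) = 0
  bijective_frobenius : Function.Bijective (fun x : R => x ^ p)

/-- The category of perfect `S`-algebras, a full subcategory of the category of `S`-algebras. -/
abbrev PerfAlg (p : ℕ) (S : Type u) [CommRing S] : Type (u + 1) :=
  ObjectProperty.FullSubcategory (C := CommAlgCat.{u} S) fun R => IsPerfectAlg p R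

section

variable (A : Type u) [CommRing A] [IsLocalRing A]

/-- The ideal `𝔭_A B` of `B` generated by the maximal ideal of `A`. -/
def extIdeal (B : Type u) [CommRing B] [Algebra A B] : Ideal B :=
  (IsLocalRing.maximalIdeal A).map (algebraMap A B)

/-- The reduction `B / 𝔭_A B`. -/
abbrev Reduction (B : Type u) [CommRing B] [Algebra A B] : Type u :=
  B ⧸ extIdeal A B

variable {A}

theorem extIdeal_le_comap {B C : Type u} [CommRing B] [Algebra A B] [CommRing C] [Algebra A C]
    (f : B →ₐ[A] C) : extIdeal A B ≤ (extIdeal A C).comap (f : B →+* C) := by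
  rw [← Ideal.map_le_iff_le_comap, extIdeal, extIdeal, Ideal.map_map, AlgHom.comp_algebraMap]

/-- The map `B / 𝔭_A B → C / 𝔭_A C` induced by a map of `A`-algebras `B → C`. -/
def reductionMap {B C : Type u} [CommRing B] [Algebra A B] [CommRing C] [Algebra A C]
    (f : B →ₐ[A] C) : Reduction A B →+* Reduction A C :=
  Ideal.quotientMap (extIdeal A C) (f : B →+* C) (extIdeal_le_comap f)

theorem reductionMap_id (B : Type u) [CommRing B] [Algebra A B] :
    reductionMap (AlgHom.id A B) = RingHom.id (Reduction A B) :=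
  Ideal.Quotient.ringHom_ext (RingHom.ext fun _ => rfl)

theorem reductionMap_comp {B C D : Type u} [CommRing B] [Algebra A B] [CommRing C] [Algebra A C]
    [CommRing D] [Algebra A D] (g : C →ₐ[A] D) (f : B →ₐ[A] C) :
    reductionMap (g.comp f) = (reductionMap g).comp (reductionMap f) :=
  Ideal.Quotient.ringHom_ext (RingHom.ext fun _ => rfl)

variable (A)

/-- `B` is a complete residual perfection of `A`: it is flat over `A`, complete (and separated)
for the `𝔭_A B`-adic topology, and `B / 𝔭_A B` is perfect. -/
structure IsCompleteResidualPerfection (p : ℕ) (B : Type u) [CommRing B] [Algebra A B] :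
    Prop where
  flat : Module.Flat A B
  complete : IsAdicComplete (extIdeal A B) B
  perfect : IsPerfectAlg p (Reduction A B)

/-- The category of complete residual perfections of `A`, a full subcategory of the category
of `A`-algebras. -/
abbrev CRP (p : ℕ) : Type (u + 1) :=
  ObjectProperty.FullSubcategory (C := CommAlgCat.{u} A)
    fun B => IsCompleteResidualPerfection A p B

variable {A} {p : ℕ}

/-- The reduction `B / 𝔭_A B` as a perfect algebra over the reduction of an initial object `U`;
the algebra structure is the reduction of the unique morphism `U ⟶ B`. -/
def reductionObj (U : CRP A p) (hU : Limits.IsInitial U) (B : CRP A p) :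
    PerfAlg p (Reduction A U.obj) where
  obj := @CommAlgCat.of (Reduction A U.obj) _ (Reduction A B.obj) _
    (reductionMap (hU.to B).hom.hom).toAlgebra
  property := B.property.perfect

/-- The functor `B ↦ B / 𝔭_A B` from complete residual perfections of `A` to perfect algebras
over the reduction of an initial object `U`. -/
def reductionFunctor (U : CRP A p) (hU : Limits.IsInitial U) :
    CRP A p ⥤ PerfAlg p (Reduction A U.obj) where
  obj B := reductionObj U hU B
  map {B C} f :=
    letI := (reductionMap (hU.to B).hom.hom).toAlgebra
    letI := (reductionMap (hU.to C).hom.hom).toAlgebra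
    ObjectProperty.homMk (CommAlgCat.ofHom
      { toRingHom := reductionMap f.hom.hom
        commutes' := fun r => by
          have h : (hU.to C).hom.hom = f.hom.hom.comp (hU.to B).hom.hom := by
            rw [← hU.to_comp f]; rfl
          change reductionMap f.hom.hom (reductionMap (hU.to B).hom.hom r) =
            reductionMap (hU.to C).hom.hom r
          rw [h, reductionMap_comp]; rfl })
  map_id B := by
    apply ObjectProperty.hom_ext
    apply CommAlgCat.hom_ext
    apply AlgHom.ext
    intro x
    exact RingHom.congr_fun (reductionMap_id (A := A) B.obj) x
  map_comp f g := by
    apply ObjectProperty.hom_ext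
    apply CommAlgCat.hom_ext
    apply AlgHom.ext
    intro x
    exact RingHom.congr_fun (reductionMap_comp g.hom.hom f.hom.hom) x

end

end ResidualPerfection

/-!
Fix a uniformizer `ϖ` of `A`. A complete flat `A`-algebra with perfect reduction `R` is the same as
a map from `A` to a lift of `R` along the image `t` of `ϖ`. Such a lift `B` receives a canonical
surjection `θ : W(R)⟦X⟧ → B`, `X ↦ t`, as in the theory of perfectoid rings, and every element of
`B` has a unique Teichmüller expansion `∑ i, θ[c i] t ^ i` with digits `c i ∈ R`. The kernel of `θ`
is generated by any of its elements `ξ` with `ξ ≡ p` modulo `X`, and such a `ξ` exists because `t`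
divides `p`. Hence a ring homomorphism `R → S` gives the lift `W(S)⟦X⟧ / (ξ)` of `S`, and a
homomorphism of residue rings compatible with maps from a common lift comes from a unique
homomorphism of lifts.

For the initial object, start with the universal lift generated by the elements of `A`: its residue
ring is the free perfect algebra on the digits of the generators, together with those of `p / t`,
from which `ξ` is built. An element of a lift maps to zero under a homomorphism of lifts exactly
when all its digits do, so the relations between the elements of `A`, and the relation `ϖ = t`, can
be imposed by dividing the residue ring by the radical ideal generated by their digits.
-/

universe v w

namespace ResidualPerfection

section Adic

theorem sModEq_span_singleton_pow_iff {B : Type*} [CommRing B] {t x y : B} {n : ℕ} :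
    x ≡ y [SMOD (Ideal.span {t} ^ n • ⊤ : Submodule B B)] ↔ t ^ n ∣ x - y := by
  rw [SModEq.sub_mem, smul_eq_mul, Ideal.mul_top, Ideal.span_singleton_pow,
    Ideal.mem_span_singleton]

theorem eq_of_forall_pow_dvd_sub {B : Type*} [CommRing B] {t x y : B}
    [IsHausdorff (Ideal.span {t}) B] (h : ∀ n, t ^ n ∣ x - y) : x = y :=
  IsHausdorff.eq_iff_smodEq.2 fun n => sModEq_span_singleton_pow_iff.2 (h n)

theorem exists_pow_pow_eq {R : Type*} [Monoid R] {p : ℕ}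
    (h : Function.Surjective fun x : R => x ^ p) (n : ℕ) (x : R) : ∃ y, y ^ p ^ n = x := by
  obtain ⟨y, rfl⟩ := h.iterate n x
  exact ⟨y, (congrFun (pow_iterate p n) y).symm⟩

/-- Modulo `I ^ (n + 1)`, the power `f c ^ p ^ n` only depends on `f c` modulo `I`, and up to
elements of `ker q` every `b` is of the form `c ^ p ^ n`. -/
theorem ringHom_ext_of_sub_mem {P R C : Type*} [CommRing P] [CommRing R] [CommRing C] {p : ℕ}
    {q : P →+* R} (hq : Function.Surjective q) (hp : (p : R) = 0)
    (hpow : Function.Surjective fun x : R => x ^ p) {s : Set P}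
    (hs : RingHom.ker q = Ideal.span s) {I : Ideal C} [IsHausdorff I C] {f g : P →+* C}
    (hfg : Set.EqOn f g s) (hI : Set.MapsTo f s I) (h : ∀ b, f b - g b ∈ I) : f = g := by
  have mem_I {d : P} (hd : d ∈ RingHom.ker q) : f d ∈ I := by
    rw [hs] at hd
    exact (Ideal.span_le (I := I.comap f)).2 hI hd
  have hpI : (p : C) ∈ I := by
    rw [← map_natCast f]
    exact mem_I (by rw [RingHom.mem_ker, map_natCast, hp])
  have sub_mem_pow (n : ℕ) : ∀ b, f b - g b ∈ I ^ n := by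
    induction n with
    | zero => simp
    | succ n ih =>
      have on_ker {d : P} (hd : d ∈ RingHom.ker q) : f d - g d ∈ I ^ (n + 1) := by
        rw [hs] at hd
        induction hd using Submodule.closure_induction with
        | zero => simp
        | add x y _ _ hx hy => simpa only [map_add, add_sub_add_comm] using add_mem hx hy
        | smul_mem a x hx =>
          rw [smul_eq_mul, map_mul, map_mul, ← hfg hx, ← sub_mul, pow_succ]
          exact Ideal.mul_mem_mul (ih a) (hI hx)
      intro b
      obtain ⟨y, hy⟩ := exists_pow_pow_eq hpow n (q b)
      obtain ⟨c, rfl⟩ := hq y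
      have hb : b - c ^ p ^ n ∈ RingHom.ker q := by
        rw [RingHom.mem_ker, map_sub, map_pow, hy, sub_self]
      have hc : f c ^ p ^ n - g c ^ p ^ n ∈ I ^ (n + 1) :=
        SModEq.sub_mem.1 (SModEq.pow_pow_add_one hpI (SModEq.sub_mem.2 (h c)) n)
      have hsplit : f b - g b = (f (b - c ^ p ^ n) - g (b - c ^ p ^ n)) +
          (f c ^ p ^ n - g c ^ p ^ n) := by
        simp only [map_sub, map_pow]
        ring
      exact hsplit ▸ add_mem (on_ker hb) hc
  refine RingHom.ext fun b => (IsHausdorff.eq_iff_smodEq (I := I)).2 fun n => ?_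
  simpa only [SModEq.sub_mem, smul_eq_mul, Ideal.mul_top] using sub_mem_pow n b

theorem isPrecomplete_of_surjective {P M N : Type*} [CommRing P] [AddCommGroup M] [Module P M]
    [AddCommGroup N] [Module P N] (I : Ideal P) [IsPrecomplete I M] {f : M →ₗ[P] N}
    (hf : Function.Surjective f) : IsPrecomplete I N := by
  rw [← AdicCompletion.of_surjective_iff]
  have h : AdicCompletion.of I N ∘ f = AdicCompletion.map I f ∘ AdicCompletion.of I M :=
    funext fun x => (AdicCompletion.map_of I f x).symm
  refine Function.Surjective.of_comp (g := f) ?_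
  rw [h]
  exact (AdicCompletion.map_surjective I hf).comp (AdicCompletion.of_surjective I M)

theorem pow_dvd_of_pow_dvd_mul {P : Type*} [CommRing P] {t ξ : P} (ht : t ∈ nonZeroDivisors P)
    (hξ : ∀ y, t ∣ ξ * y → t ∣ y) (n : ℕ) {y : P} (hy : t ^ n ∣ ξ * y) : t ^ n ∣ y := by
  induction n generalizing y with
  | zero => simp
  | succ n ih =>
    obtain ⟨z, rfl⟩ := hξ y ((dvd_pow_self t n.succ_ne_zero).trans hy)
    rw [pow_succ', mul_left_comm, dvd_cancel_left_mem_nonZeroDivisors ht] at hy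
    exact pow_succ' t n ▸ mul_dvd_mul_left t (ih hy)

theorem mk_mem_nonZeroDivisors {P : Type*} [CommRing P] {t ξ : P} (ht : t ∈ nonZeroDivisors P)
    (hξ : ∀ y, t ∣ ξ * y → t ∣ y) :
    Ideal.Quotient.mk (Ideal.span {ξ}) t ∈ nonZeroDivisors (P ⧸ Ideal.span {ξ}) := by
  rw [mem_nonZeroDivisors_iff_right]
  intro x hx
  obtain ⟨w, rfl⟩ := Ideal.Quotient.mk_surjective x
  rw [← map_mul, Ideal.Quotient.eq_zero_iff_mem, Ideal.mem_span_singleton] at hx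
  obtain ⟨y, hy⟩ := hx
  obtain ⟨z, rfl⟩ := hξ y (Dvd.intro_left w hy)
  rw [Ideal.Quotient.eq_zero_iff_mem, Ideal.mem_span_singleton]
  exact ⟨z, (mul_cancel_left_mem_nonZeroDivisors ht).1 (by rw [mul_comm t w, hy, mul_left_comm])⟩

theorem isAdicComplete_quotient_span_singleton {P : Type*} [CommRing P] {t ξ : P}
    [IsAdicComplete (Ideal.span {t}) P] (hξ : ∀ n y, t ^ n ∣ ξ * y → t ^ n ∣ y) :
    IsAdicComplete (Ideal.span {Ideal.Quotient.mk (Ideal.span {ξ}) t}) (P ⧸ Ideal.span {ξ}) := by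
  have hmap : Ideal.span {Ideal.Quotient.mk (Ideal.span {ξ}) t} =
      (Ideal.span {t}).map (algebraMap P (P ⧸ Ideal.span {ξ})) := by
    rw [Ideal.map_span, Set.image_singleton, Ideal.Quotient.algebraMap_eq]
  have : IsPrecomplete (Ideal.span {t}) (P ⧸ Ideal.span {ξ}) :=
    isPrecomplete_of_surjective _ (Submodule.mkQ_surjective (Ideal.span {ξ}))
  refine { toIsHausdorff := ⟨fun x hx => ?_⟩
           toIsPrecomplete := hmap ▸ IsPrecomplete.map_algebraMap_iff.2 this }
  obtain ⟨w, rfl⟩ := Ideal.Quotient.mk_surjective x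
  have approx (n : ℕ) : ∃ y, t ^ n ∣ w - ξ * y := by
    obtain ⟨v, hv⟩ := sModEq_span_singleton_pow_iff.1 (hx n)
    obtain ⟨v, rfl⟩ := Ideal.Quotient.mk_surjective v
    rw [sub_zero, ← map_pow, ← map_mul, Ideal.Quotient.eq, Ideal.mem_span_singleton] at hv
    obtain ⟨y, hy⟩ := hv
    exact ⟨y, v, by rw [← hy]; ring⟩
  choose y hy using approx
  have cauchy {m n : ℕ} (hmn : m ≤ n) :
      y m ≡ y n [SMOD (Ideal.span {t} ^ m • ⊤ : Submodule P P)] := by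
    refine sModEq_span_singleton_pow_iff.2 (hξ m _ ?_)
    have := dvd_sub ((pow_dvd_pow t hmn).trans (hy n)) (hy m)
    rwa [sub_sub_sub_cancel_left, ← mul_sub] at this
  obtain ⟨L, hL⟩ := IsPrecomplete.prec' (I := Ideal.span {t}) y cauchy
  have hw : w = ξ * L := eq_of_forall_pow_dvd_sub (t := t) fun n => by
    have := dvd_add (hy n) ((sModEq_span_singleton_pow_iff.1 (hL n)).mul_left ξ)
    rwa [mul_sub, sub_add_sub_cancel] at this
  rw [Ideal.Quotient.eq_zero_iff_mem, Ideal.mem_span_singleton]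
  exact ⟨L, hw⟩

theorem exists_powerSeries_eval {S B : Type*} [CommRing S] [CommRing B] (I : Ideal B)
    [IsAdicComplete I B] (φ : S →+* B) {t : B} (ht : t ∈ I) :
    ∃ Φ : PowerSeries S →+* B, Φ PowerSeries.X = t ∧ ∀ s, Φ (PowerSeries.C s) = φ s := by
  let : WithIdeal B := ⟨I⟩
  let : UniformSpace S := ⊥
  have : DiscreteUniformity S := ⟨rfl⟩
  obtain ⟨_, _⟩ := (IsAdic.isAdicComplete_iff (R := B) (I := I) rfl).1 inferInstance
  have hφ : Continuous φ := continuous_of_discreteTopology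
  have ht : PowerSeries.HasEval t := WithIdeal.isTopologicallyNilpotent_of_mem ht
  refine ⟨PowerSeries.eval₂Hom hφ ht, ?_, fun s => ?_⟩
  · rw [PowerSeries.coe_eval₂Hom, PowerSeries.eval₂_X]
  · rw [PowerSeries.coe_eval₂Hom, PowerSeries.eval₂_C]

end Adic

section Witt

variable {p : ℕ}

theorem subsingleton_wittVector {R : Type*} [Subsingleton R] : Subsingleton (WittVector p R) :=
  ⟨fun _ _ => WittVector.ext fun _ => Subsingleton.elim _ _⟩

namespace IsPerfectAlg

variable [Fact p.Prime] {R : Type*} [CommRing R]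

theorem subsingleton_or_charP (h : IsPerfectAlg p R) :
    Subsingleton R ∨ (CharP R p ∧ PerfectRing R p) := by
  cases subsingleton_or_nontrivial R with
  | inl hR => exact .inl hR
  | inr hR =>
    exact .inr ⟨(CharP.charP_iff_prime_eq_zero Fact.out).2 h.cast_eq_zero,
      ⟨h.bijective_frobenius⟩⟩

theorem wittVector_frobenius_bijective (h : IsPerfectAlg p R) :
    Function.Bijective (WittVector.frobenius : WittVector p R →+* WittVector p R) := by
  obtain _ | ⟨_, _⟩ := h.subsingleton_or_charP
  · have : Subsingleton (WittVector p R) := subsingleton_wittVector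
    exact ⟨Function.injective_of_subsingleton _, Function.surjective_to_subsingleton _⟩
  · exact WittVector.frobenius_bijective p R

theorem natCast_mem_nonZeroDivisors_wittVector (h : IsPerfectAlg p R) :
    (p : WittVector p R) ∈ nonZeroDivisors (WittVector p R) := by
  rw [mem_nonZeroDivisors_iff_right]
  intro x hx
  obtain _ | ⟨_, _⟩ := h.subsingleton_or_charP
  · exact subsingleton_wittVector.elim _ _
  · exact WittVector.eq_zero_of_p_mul_eq_zero x hx

theorem natCast_dvd_wittVector_iff (h : IsPerfectAlg p R) {x : WittVector p R} :
    (p : WittVector p R) ∣ x ↔ WittVector.constantCoeff x = 0 := by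
  obtain _ | ⟨_, _⟩ := h.subsingleton_or_charP
  · have : Subsingleton (WittVector p R) := subsingleton_wittVector
    exact iff_of_true (Subsingleton.elim _ x ▸ dvd_rfl) (Subsingleton.elim _ _)
  · rw [← Ideal.mem_span_singleton, WittVector.mem_span_p_iff_coeff_zero_eq_zero,
      WittVector.constantCoeff_apply]

end IsPerfectAlg

variable [Fact p.Prime]

theorem wittVector_map_frobenius {R S : Type*} [CommRing R] [CommRing S] (f : R →+* S)
    (x : WittVector p R) :
    WittVector.map f (WittVector.frobenius x) = WittVector.frobenius (WittVector.map f x) := by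
  ext n
  rw [WittVector.map_coeff, WittVector.coeff_frobenius, WittVector.coeff_frobenius]
  simp only [MvPolynomial.aeval_eq_eval₂Hom, MvPolynomial.map_eval₂Hom]
  congr 2
  exact RingHom.ext_int _ _

theorem ghostComponent_mem_pow {B : Type*} [CommRing B] {I : Ideal B} (hp : (p : B) ∈ I)
    {x : WittVector p B} (hx : ∀ i, x.coeff i ∈ I) (n : ℕ) :
    WittVector.ghostComponent n x ∈ I ^ (n + 1) := by
  rw [WittVector.ghostComponent_apply, wittPolynomial, map_sum]
  refine Ideal.sum_mem _ fun i hi => ?_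
  rw [MvPolynomial.aeval_monomial, Finsupp.prod_single_index (by simp), map_pow,
    map_natCast]
  have hle : n + 1 ≤ i + p ^ (n - i) := by
    have := Finset.mem_range.1 hi
    have := Nat.lt_pow_self (n := n - i) (Fact.out : p.Prime).one_lt
    lia
  refine Ideal.pow_le_pow_right hle ?_
  rw [pow_add]
  exact Ideal.mul_mem_mul (Ideal.pow_mem_pow hp i) (Ideal.pow_mem_pow (hx i) _)

variable {B R : Type*} [CommRing B] [CommRing R] {q : B →+* R}

theorem ker_wittVector_map_le (hp : (p : R) = 0) (n : ℕ) :
    RingHom.ker (WittVector.map (p := p) q) ≤ RingHom.ker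
      ((Ideal.Quotient.mk (RingHom.ker q ^ (n + 1))).comp (WittVector.ghostComponent n)) := by
  intro x hx
  rw [RingHom.mem_ker, RingHom.comp_apply, Ideal.Quotient.eq_zero_iff_mem]
  refine ghostComponent_mem_pow (by rwa [RingHom.mem_ker, map_natCast]) (fun i => ?_) n
  rw [RingHom.mem_ker, ← WittVector.map_coeff, RingHom.mem_ker.1 hx, WittVector.zero_coeff]

/-- The factorization of the `n`-th ghost component `W(B) → B → B / (ker q) ^ (n + 1)` through
`W(q) : W(B) → W(R)`. -/
noncomputable def ghostComponentModPow (hq : Function.Surjective q) (hp : (p : R) = 0) (n : ℕ) :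
    WittVector p R →+* B ⧸ RingHom.ker q ^ (n + 1) :=
  RingHom.liftOfSurjective (WittVector.map q) (WittVector.map_surjective q hq)
    ⟨_, ker_wittVector_map_le hp n⟩

theorem ghostComponentModPow_map (hq : Function.Surjective q) (hp : (p : R) = 0) (n : ℕ)
    (x : WittVector p B) :
    ghostComponentModPow hq hp n (WittVector.map q x) =
      Ideal.Quotient.mk _ (WittVector.ghostComponent n x) :=
  RingHom.liftOfSurjective_comp_apply ..

theorem factorPow_ghostComponentModPow (hq : Function.Surjective q) (hp : (p : R) = 0) (n : ℕ)
    (y : WittVector p R) :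
    Ideal.Quotient.factorPow (RingHom.ker q) n.succ.le_succ (ghostComponentModPow hq hp (n + 1) y) =
      ghostComponentModPow hq hp n (WittVector.frobenius y) := by
  obtain ⟨x, rfl⟩ := WittVector.map_surjective q hq y
  rw [← wittVector_map_frobenius, ghostComponentModPow_map, ghostComponentModPow_map,
    WittVector.ghostComponent_frobenius]
  rfl

theorem exists_wittVector_lift [IsAdicComplete (RingHom.ker q) B] (hq : Function.Surjective q)
    (hR : IsPerfectAlg p R) :
    ∃ θ : WittVector p R →+* B, ∀ w, q (θ w) = WittVector.constantCoeff w := by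
  let F := RingEquiv.ofBijective _ hR.wittVector_frobenius_bijective
  let θ (n : ℕ) : WittVector p R →+* B ⧸ RingHom.ker q ^ (n + 1) :=
    (ghostComponentModPow hq hR.cast_eq_zero n).comp ((F.symm : WittVector p R →+* _) ^ n)
  have hθ {n : ℕ} :
      (Ideal.Quotient.factorPow (RingHom.ker q) n.succ.le_succ).comp (θ (n + 1)) = θ n := by
    ext y
    simp only [θ, RingHom.comp_apply, factorPow_ghostComponentModPow, pow_succ']
    exact congrArg _ (F.apply_symm_apply _)
  refine ⟨IsAdicComplete.StrictMono.liftRingHom _ Order.succ_strictMono θ hθ, fun w => ?_⟩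
  obtain ⟨x, rfl⟩ := WittVector.map_surjective q hq w
  have h0 := (IsAdicComplete.StrictMono.mk_liftRingHom _ Order.succ_strictMono θ hθ (n := 0)
    (WittVector.map q x)).trans (ghostComponentModPow_map hq hR.cast_eq_zero 0 x)
  have h1 := Ideal.pow_le_self one_ne_zero (Ideal.Quotient.eq.1 h0)
  rw [RingHom.mem_ker, map_sub, sub_eq_zero] at h1
  rw [h1, WittVector.constantCoeff_apply, WittVector.map_coeff, WittVector.ghostComponent_apply,
    wittPolynomial_zero, MvPolynomial.aeval_X]

end Witt

open PowerSeries

section WittSeries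

variable {p : ℕ} [Fact p.Prime] {R S T : Type*} [CommRing R] [CommRing S] [CommRing T]

variable (p R) in
/-- The ring `W(R)⟦X⟧`, of which every lift of a perfect `𝔽_p`-algebra `R` is a quotient, with
uniformizer the image of `X`. -/
abbrev WittSeries := PowerSeries (WittVector p R)

namespace WittSeries

/-- The functoriality of `W(R)⟦X⟧` in `R`. -/
noncomputable def map (g : R →+* S) : WittSeries p R →+* WittSeries p S :=
  PowerSeries.map (WittVector.map g)

variable (p R) in
/-- The residue map `W(R)⟦X⟧ → R`, whose kernel is generated by `X` and `p` when `R` is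
perfect. -/
noncomputable def residue : WittSeries p R →+* R :=
  WittVector.constantCoeff.comp PowerSeries.constantCoeff

theorem residue_apply (w : WittSeries p R) :
    residue p R w = WittVector.constantCoeff (constantCoeff w) := rfl

variable (p) in
/-- The Teichmüller expansion `∑ i, [c i] X ^ i`. -/
noncomputable def teichmuller (c : ℕ → R) : WittSeries p R :=
  PowerSeries.mk fun i => WittVector.teichmuller p (c i)

theorem map_X (g : R →+* S) : map g (X : WittSeries p R) = X :=
  PowerSeries.map_X _

theorem constantCoeff_map (g : R →+* S) (w : WittSeries p R) :
    constantCoeff (map g w) = WittVector.map g (constantCoeff w) := by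
  rw [← coeff_zero_eq_constantCoeff_apply, ← coeff_zero_eq_constantCoeff_apply, map, coeff_map]

theorem residue_map (g : R →+* S) (w : WittSeries p R) :
    residue p S (map g w) = g (residue p R w) := by
  rw [residue_apply, constantCoeff_map, WittVector.constantCoeff_apply, WittVector.map_coeff]
  rfl

theorem map_map (g : S →+* T) (f : R →+* S) (w : WittSeries p R) :
    map g (map f w) = map (g.comp f) w := by
  ext n
  simp [map]

theorem map_teichmuller (g : R →+* S) (c : ℕ → R) :
    map g (teichmuller p c) = teichmuller p (g ∘ c) := by
  ext n
  simp [map, teichmuller]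

theorem residue_teichmuller (c : ℕ → R) : residue p R (teichmuller p c) = c 0 := by
  simp [residue_apply, teichmuller]

theorem teichmuller_zero : teichmuller p (0 : ℕ → R) = 0 := by
  ext
  simp [teichmuller]

theorem teichmuller_eq_X_mul_add (c : ℕ → R) : teichmuller p c =
    X * teichmuller p (fun i => c (i + 1)) + C (WittVector.teichmuller p (c 0)) := by
  conv_lhs => rw [eq_X_mul_shift_add_const (teichmuller p c)]
  simp [teichmuller]

theorem residue_surjective : Function.Surjective (residue p R) := fun r =>
  ⟨teichmuller p fun _ => r, residue_teichmuller _⟩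

theorem X_dvd_sub_mul_C {ξ w : WittSeries p R} (hR : IsPerfectAlg p R)
    (hξ : constantCoeff ξ = p) (hw : residue p R w = 0) : ∃ v, X ∣ w - ξ * C v := by
  obtain ⟨v, hv⟩ := hR.natCast_dvd_wittVector_iff.2 hw
  exact ⟨v, X_dvd_iff.2 (by rw [map_sub, map_mul, hξ, constantCoeff_C, hv, sub_self])⟩

theorem ker_residue {ξ : WittSeries p R} (hR : IsPerfectAlg p R) (hξ : constantCoeff ξ = p) :
    RingHom.ker (residue p R) = Ideal.span {X, ξ} := by
  refine le_antisymm (fun w hw => ?_) ?_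
  · obtain ⟨v, u, hu⟩ := X_dvd_sub_mul_C hR hξ hw
    exact Ideal.mem_span_pair.2 ⟨u, C v, by linear_combination -hu⟩
  · refine Ideal.span_le.2 (Set.pair_subset ?_ ?_)
    · simp [residue_apply]
    · simp [residue_apply, hξ, hR.cast_eq_zero]

end WittSeries

end WittSeries

section Lifts

variable {B R D S E T : Type*} [CommRing B] [CommRing R] [CommRing D] [CommRing S] [CommRing E]
  [CommRing T]

/-- `B` is a lift of the perfect `𝔽_p`-algebra `R` along the nonzerodivisor `t`: it is `t`-adically
complete, and `q` identifies `B / t` with `R`. -/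
structure IsPerfectLift (p : ℕ) (t : B) (q : B →+* R) : Prop where
  mem_nonZeroDivisors : t ∈ nonZeroDivisors B
  isAdicComplete : IsAdicComplete (Ideal.span {t}) B
  surjective : Function.Surjective q
  ker_eq : RingHom.ker q = Ideal.span {t}
  perfect : IsPerfectAlg p R

/-- `f` is a homomorphism over `g`, compatible with the uniformizers `t`, `t'` and the residue maps
`q`, `q'`. No lifts are involved in the definition, so that it also applies to `W(R)⟦X⟧`. -/
structure IsLiftHom (t : B) (q : B →+* R) (t' : D) (q' : D →+* S) (f : B →+* D) (g : R →+* S) :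
    Prop where
  map_uniformizer : f t = t'
  map_residue (b : B) : q' (f b) = g (q b)

variable {p : ℕ} {t : B} {q : B →+* R} {t' : D} {q' : D →+* S} {t'' : E} {q'' : E →+* T}
  {f : B →+* D} {g : R →+* S}

theorem IsLiftHom.comp {f' : D →+* E} {g' : S →+* T} (h' : IsLiftHom t' q' t'' q'' f' g')
    (h : IsLiftHom t q t' q' f g) : IsLiftHom t q t'' q'' (f'.comp f) (g'.comp g) where
  map_uniformizer := by rw [RingHom.comp_apply, h.map_uniformizer, h'.map_uniformizer]
  map_residue b := by simp only [RingHom.comp_apply, h.map_residue, h'.map_residue]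

theorem WittSeries.isLiftHom_map [Fact p.Prime] (g : R →+* S) :
    IsLiftHom X (residue p R) X (residue p S) (map g) g :=
  ⟨map_X g, residue_map g⟩

namespace IsPerfectLift

theorem map_eq_zero_iff (h : IsPerfectLift p t q) {x : B} : q x = 0 ↔ t ∣ x := by
  rw [← RingHom.mem_ker, h.ker_eq, Ideal.mem_span_singleton]

theorem map_uniformizer (h : IsPerfectLift p t q) : q t = 0 := h.map_eq_zero_iff.2 dvd_rfl

theorem map_eq_iff_dvd_sub (h : IsPerfectLift p t q) {x y : B} : q x = q y ↔ t ∣ x - y := by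
  rw [← h.map_eq_zero_iff, map_sub, sub_eq_zero]

theorem dvd_natCast (h : IsPerfectLift p t q) : t ∣ (p : B) := by
  rw [← h.map_eq_zero_iff, map_natCast, h.perfect.cast_eq_zero]

theorem isHausdorff (h : IsPerfectLift p t q) : IsHausdorff (Ideal.span {t}) B :=
  h.isAdicComplete.toIsHausdorff

theorem exists_reduction (hB : IsPerfectLift p t q) (hD : IsPerfectLift p t' q')
    (hf : f t = t') : ∃ g : R →+* S, IsLiftHom t q t' q' f g := by
  have hker : RingHom.ker q ≤ RingHom.ker (q'.comp f) := by
    rw [hB.ker_eq, Ideal.span_singleton_le_iff_mem, RingHom.mem_ker, RingHom.comp_apply, hf,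
      hD.map_uniformizer]
  exact ⟨RingHom.liftOfSurjective q hB.surjective ⟨_, hker⟩, hf, fun b =>
    (RingHom.liftOfSurjective_comp_apply q hB.surjective ⟨_, hker⟩ b).symm⟩

theorem hom_ext (hB : IsPerfectLift p t q) (hD : IsPerfectLift p t' q') {f' : B →+* D}
    (h : IsLiftHom t q t' q' f g) (h' : IsLiftHom t q t' q' f' g) : f = f' := by
  have := hD.isHausdorff
  refine ringHom_ext_of_sub_mem (I := Ideal.span {t'}) hB.surjective hB.perfect.cast_eq_zero
    hB.perfect.bijective_frobenius.2 hB.ker_eq ?_ ?_ fun b => ?_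
  · rw [Set.eqOn_singleton, h.map_uniformizer, h'.map_uniformizer]
  · rw [Set.mapsTo_singleton, h.map_uniformizer]
    exact Ideal.mem_span_singleton_self t'
  · rw [Ideal.mem_span_singleton, ← hD.map_eq_iff_dvd_sub, h.map_residue, h'.map_residue]

variable [Fact p.Prime]

theorem wittSeries_hom_ext (hR : IsPerfectAlg p R) (hD : IsPerfectLift p t' q')
    {f f' : WittSeries p R →+* D} (h : IsLiftHom X (WittSeries.residue p R) t' q' f g)
    (h' : IsLiftHom X (WittSeries.residue p R) t' q' f' g) : f = f' := by
  have := hD.isHausdorff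
  refine ringHom_ext_of_sub_mem (I := Ideal.span {t'}) WittSeries.residue_surjective
    hR.cast_eq_zero hR.bijective_frobenius.2
    (WittSeries.ker_residue hR (ξ := p) (map_natCast _ p)) ?_ ?_ fun b => ?_
  · rintro _ (rfl | rfl)
    · rw [h.map_uniformizer, h'.map_uniformizer]
    · rw [map_natCast, map_natCast]
  · rintro _ (rfl | rfl) <;> rw [SetLike.mem_coe, Ideal.mem_span_singleton]
    · rw [h.map_uniformizer]
    · rw [map_natCast]
      exact hD.dvd_natCast
  · rw [Ideal.mem_span_singleton, ← hD.map_eq_iff_dvd_sub, h.map_residue, h'.map_residue]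

theorem exists_theta (h : IsPerfectLift p t q) : ∃ Θ : WittSeries p R →+* B,
    IsLiftHom X (WittSeries.residue p R) t q Θ (RingHom.id R) := by
  have := h.isAdicComplete
  have : IsAdicComplete (RingHom.ker q) B := h.ker_eq ▸ h.isAdicComplete
  obtain ⟨θ, hθ⟩ := exists_wittVector_lift h.surjective h.perfect
  obtain ⟨Θ, hX, hC⟩ :=
    exists_powerSeries_eval (Ideal.span {t}) θ (Ideal.mem_span_singleton_self t)
  refine ⟨Θ, hX, fun w => ?_⟩
  rw [eq_X_mul_shift_add_const w]
  simp only [map_add, map_mul, hX, hC, hθ, h.map_uniformizer, WittSeries.residue_apply,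
    constantCoeff_X, map_zero, zero_mul, zero_add, constantCoeff_C, RingHom.id_apply]

/-- The canonical map `W(R)⟦X⟧ → B` to a lift `B` of `R`, analogous to Fontaine's map `θ`. -/
noncomputable def theta (h : IsPerfectLift p t q) : WittSeries p R →+* B :=
  h.exists_theta.choose

theorem isLiftHom_theta (h : IsPerfectLift p t q) :
    IsLiftHom X (WittSeries.residue p R) t q h.theta (RingHom.id R) :=
  h.exists_theta.choose_spec

theorem map_theta (h : IsPerfectLift p t q) (w : WittSeries p R) :
    q (h.theta w) = WittSeries.residue p R w :=
  h.isLiftHom_theta.map_residue w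

theorem theta_X (h : IsPerfectLift p t q) : h.theta X = t :=
  h.isLiftHom_theta.map_uniformizer

theorem theta_unique (h : IsPerfectLift p t q) {f : WittSeries p R →+* B}
    (hf : IsLiftHom X (WittSeries.residue p R) t q f (RingHom.id R)) : f = h.theta :=
  wittSeries_hom_ext h.perfect h hf h.isLiftHom_theta

theorem map_theta_eq_theta_map (hB : IsPerfectLift p t q) (hD : IsPerfectLift p t' q')
    (h : IsLiftHom t q t' q' f g) (w : WittSeries p R) :
    f (hB.theta w) = hD.theta (WittSeries.map g w) :=
  RingHom.congr_fun (wittSeries_hom_ext hB.perfect hD (h.comp hB.isLiftHom_theta)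
    (hD.isLiftHom_theta.comp (WittSeries.isLiftHom_map g))) w

theorem theta_surjective (h : IsPerfectLift p t q) : Function.Surjective h.theta := by
  have hmap : (Ideal.span {X}).map h.theta = RingHom.ker q := by
    rw [Ideal.map_span, Set.image_singleton, h.theta_X, h.ker_eq]
  have : IsHausdorff ((Ideal.span {X}).map h.theta) B := by
    rw [hmap, h.ker_eq]
    exact h.isHausdorff
  refine surjective_of_mk_map_comp_surjective (I := Ideal.span {X}) h.theta fun x => ?_
  obtain ⟨b, rfl⟩ := Ideal.Quotient.mk_surjective x
  obtain ⟨w, hw⟩ := WittSeries.residue_surjective (p := p) (q b)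
  refine ⟨w, Ideal.Quotient.eq.2 ?_⟩
  rw [hmap, RingHom.mem_ker, map_sub, h.map_theta, hw, sub_self]

/-- The element `∑ i, [c i] t ^ i` of a lift. -/
noncomputable def expansion (h : IsPerfectLift p t q) (c : ℕ → R) : B :=
  h.theta (WittSeries.teichmuller p c)

theorem map_expansion (h : IsPerfectLift p t q) (c : ℕ → R) : q (h.expansion c) = c 0 := by
  rw [expansion, map_theta, WittSeries.residue_teichmuller]

theorem expansion_eq_mul_add (h : IsPerfectLift p t q) (c : ℕ → R) : h.expansion c =
    t * h.expansion (fun i => c (i + 1)) + h.theta (C (WittVector.teichmuller p (c 0))) := by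
  rw [expansion, WittSeries.teichmuller_eq_X_mul_add, map_add, map_mul, theta_X, expansion]

theorem expansion_zero (h : IsPerfectLift p t q) : h.expansion 0 = 0 := by
  rw [expansion, WittSeries.teichmuller_zero, map_zero]

theorem map_expansion_eq_expansion_comp (hB : IsPerfectLift p t q) (hD : IsPerfectLift p t' q')
    (h : IsLiftHom t q t' q' f g) (c : ℕ → R) : f (hB.expansion c) = hD.expansion (g ∘ c) := by
  rw [expansion, hB.map_theta_eq_theta_map hD h, WittSeries.map_teichmuller, expansion]

theorem expansion_injective (h : IsPerfectLift p t q) : Function.Injective h.expansion := by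
  have first_digit_eq {c d : ℕ → R} (hcd : h.expansion c = h.expansion d) : c 0 = d 0 := by
    rw [← h.map_expansion c, hcd, h.map_expansion]
  have digit_eq (n : ℕ) {c d : ℕ → R} (hcd : h.expansion c = h.expansion d) : c n = d n := by
    induction n generalizing c d with
    | zero => exact first_digit_eq hcd
    | succ _ ih =>
      have h0 := first_digit_eq hcd
      rw [h.expansion_eq_mul_add c, h.expansion_eq_mul_add d, h0, add_left_inj,
        mul_cancel_left_mem_nonZeroDivisors h.mem_nonZeroDivisors] at hcd
      exact ih hcd
  exact fun c d hcd => funext fun n => digit_eq n hcd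

theorem expansion_surjective (h : IsPerfectLift p t q) : Function.Surjective h.expansion := by
  intro b
  have exists_shift (x : B) : ∃ y, x = t * y + h.theta (C (WittVector.teichmuller p (q x))) := by
    obtain ⟨y, hy⟩ : t ∣ x - h.theta (C (WittVector.teichmuller p (q x))) := by
      rw [← h.map_eq_iff_dvd_sub, h.map_theta, WittSeries.residue_apply, constantCoeff_C,
        WittVector.constantCoeff_apply, WittVector.teichmuller_coeff_zero]
    exact ⟨y, sub_eq_iff_eq_add.1 hy⟩
  choose s hs using exists_shift
  have approx (n : ℕ) : ∀ x, t ^ n ∣ x - h.expansion fun i => q (s^[i] x) := by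
    induction n with
    | zero => simp
    | succ n ih =>
      intro x
      have hx : x - h.expansion (fun i => q (s^[i] x)) =
          t * (s x - h.expansion fun i => q (s^[i] (s x))) := by
        rw [h.expansion_eq_mul_add, mul_sub]
        nth_rewrite 1 [hs x]
        exact add_sub_add_right_eq_sub ..
      rw [hx, pow_succ']
      exact mul_dvd_mul_left t (ih (s x))
  have := h.isHausdorff
  exact ⟨fun i => q (s^[i] b), (eq_of_forall_pow_dvd_sub fun n => approx n b).symm⟩

/-- The digits of the Teichmüller expansion of an element of a lift. -/
noncomputable def digits (h : IsPerfectLift p t q) (b : B) : ℕ → R :=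
  Function.surjInv h.expansion_surjective b

theorem expansion_digits (h : IsPerfectLift p t q) (b : B) : h.expansion (h.digits b) = b :=
  Function.surjInv_eq h.expansion_surjective b

theorem map_eq_zero_iff_digits (hB : IsPerfectLift p t q) (hD : IsPerfectLift p t' q')
    (h : IsLiftHom t q t' q' f g) {b : B} : f b = 0 ↔ ∀ i, g (hB.digits b i) = 0 := by
  rw [← hD.expansion_zero, ← congrArg f (hB.expansion_digits b),
    hB.map_expansion_eq_expansion_comp hD h, hD.expansion_injective.eq_iff, funext_iff]
  rfl

end IsPerfectLift

end Lifts

section Construction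

variable {p : ℕ} [Fact p.Prime] {B R D S E T : Type*} [CommRing B] [CommRing R] [CommRing D]
  [CommRing S] [CommRing E] [CommRing T]

/-- The ring `W(R)⟦X⟧ / (ξ)`. When `R` is perfect and `ξ ≡ p` modulo `X`, it is a lift of `R` along
the image of `X`, and every lift of `R` is of this form. -/
abbrev WittQuotient (ξ : WittSeries p R) := WittSeries p R ⧸ Ideal.span {ξ}

namespace WittQuotient

/-- The residue map of `W(R)⟦X⟧ / (ξ)`. -/
noncomputable def residue (hR : IsPerfectAlg p R) {ξ : WittSeries p R}
    (hξ : constantCoeff ξ = p) : WittQuotient ξ →+* R :=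
  Ideal.Quotient.lift _ (WittSeries.residue p R) fun _ hx =>
    RingHom.mem_ker.1 <| WittSeries.ker_residue hR hξ ▸
      Ideal.span_mono (Set.subset_insert X {ξ}) hx

variable (p R) in
theorem X_mem_nonZeroDivisors : (X : WittSeries p R) ∈ nonZeroDivisors (WittSeries p R) :=
  MvPowerSeries.X_mem_nonzeroDivisors

theorem X_dvd_of_X_dvd_mul (hR : IsPerfectAlg p R) {ξ : WittSeries p R}
    (hξ : constantCoeff ξ = p) (y : WittSeries p R) (hy : X ∣ ξ * y) : X ∣ y := by
  rw [X_dvd_iff, map_mul, hξ] at hy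
  exact X_dvd_iff.2 ((mul_right_mem_nonZeroDivisors_eq_zero_iff
    hR.natCast_mem_nonZeroDivisors_wittVector).1 (by rwa [mul_comm]))

theorem ker_residue (hR : IsPerfectAlg p R) {ξ : WittSeries p R} (hξ : constantCoeff ξ = p) :
    RingHom.ker (residue hR hξ) = Ideal.span {Ideal.Quotient.mk (Ideal.span {ξ}) X} := by
  refine (Ideal.ker_quotient_lift (WittSeries.residue p R) _).trans ?_
  rw [WittSeries.ker_residue hR hξ, Ideal.map_span, Set.image_pair,
    Ideal.Quotient.mk_singleton_self, Set.pair_comm, Ideal.span_insert_zero]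

theorem isPerfectLift (hR : IsPerfectAlg p R) {ξ : WittSeries p R} (hξ : constantCoeff ξ = p) :
    IsPerfectLift p (Ideal.Quotient.mk (Ideal.span {ξ}) X) (residue hR hξ) where
  mem_nonZeroDivisors :=
    mk_mem_nonZeroDivisors (X_mem_nonZeroDivisors p R) (X_dvd_of_X_dvd_mul hR hξ)
  isAdicComplete := isAdicComplete_quotient_span_singleton fun n _ =>
    pow_dvd_of_pow_dvd_mul (X_mem_nonZeroDivisors p R) (X_dvd_of_X_dvd_mul hR hξ) n
  surjective := Ideal.Quotient.lift_surjective_of_surjective _ _ WittSeries.residue_surjective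
  ker_eq := ker_residue hR hξ
  perfect := hR

theorem theta_eq_mk (hR : IsPerfectAlg p R) {ξ : WittSeries p R} (hξ : constantCoeff ξ = p) :
    (isPerfectLift hR hξ).theta = Ideal.Quotient.mk (Ideal.span {ξ}) :=
  ((isPerfectLift hR hξ).theta_unique ⟨rfl, fun _ => rfl⟩).symm

theorem theta_self (hR : IsPerfectAlg p R) {ξ : WittSeries p R} (hξ : constantCoeff ξ = p) :
    (isPerfectLift hR hξ).theta ξ = 0 := by
  rw [theta_eq_mk, Ideal.Quotient.mk_singleton_self]

end WittQuotient

namespace IsPerfectLift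

variable {t : B} {q : B →+* R} {t' : D} {q' : D →+* S} {t'' : E} {q'' : E →+* T}

theorem injective_of_injective (hB : IsPerfectLift p t q) (hD : IsPerfectLift p t' q')
    {f : B →+* D} {g : R →+* S} (h : IsLiftHom t q t' q' f g) (hg : Function.Injective g) :
    Function.Injective f := by
  refine (injective_iff_map_eq_zero f).2 fun b hb => ?_
  have hdigits : hB.digits b = 0 := funext fun i =>
    (_root_.map_eq_zero_iff g hg).1 ((hB.map_eq_zero_iff_digits hD h).1 hb i)
  rw [← hB.expansion_digits b, hdigits, hB.expansion_zero]

theorem surjective_of_surjective (hB : IsPerfectLift p t q) (hD : IsPerfectLift p t' q')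
    {f : B →+* D} {g : R →+* S} (h : IsLiftHom t q t' q' f g) (hg : Function.Surjective g) :
    Function.Surjective f := by
  intro d
  obtain ⟨c, hc : g ∘ c = hD.digits d⟩ := hg.comp_left (hD.digits d)
  exact ⟨hB.expansion c, by rw [hB.map_expansion_eq_expansion_comp hD h, hc, hD.expansion_digits]⟩

theorem exists_theta_eq_zero (h : IsPerfectLift p t q) :
    ∃ ξ : WittSeries p R, constantCoeff ξ = p ∧ h.theta ξ = 0 := by
  obtain ⟨c, hc⟩ := h.dvd_natCast
  obtain ⟨w, rfl⟩ := h.theta_surjective c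
  refine ⟨(p : WittSeries p R) - X * w, ?_, ?_⟩
  · rw [map_sub, map_natCast, map_mul, constantCoeff_X, zero_mul, sub_zero]
  · rw [map_sub, map_natCast, map_mul, theta_X, hc, sub_self]

theorem ker_theta (h : IsPerfectLift p t q) {ξ : WittSeries p R} (hξ : constantCoeff ξ = p)
    (hξ₀ : h.theta ξ = 0) : RingHom.ker h.theta = Ideal.span {ξ} := by
  have hle : Ideal.span {ξ} ≤ RingHom.ker h.theta := (Ideal.span_singleton_le_iff_mem _).2 hξ₀
  refine (Ideal.injective_lift_iff hle).1 ?_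
  refine (WittQuotient.isPerfectLift h.perfect hξ).injective_of_injective h (g := RingHom.id R)
    (f := Ideal.Quotient.lift _ h.theta hle) ⟨h.theta_X, fun x => ?_⟩ Function.injective_id
  obtain ⟨w, rfl⟩ := Ideal.Quotient.mk_surjective x
  exact h.map_theta w

theorem exists_lift (hB : IsPerfectLift p t q) (hD : IsPerfectLift p t' q') (g : R →+* S)
    {ξ : WittSeries p R} (hξ : constantCoeff ξ = p) (hBξ : hB.theta ξ = 0)
    (hDξ : hD.theta (WittSeries.map g ξ) = 0) :
    ∃ f : B →+* D, IsLiftHom t q t' q' f g := by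
  have hker : RingHom.ker hB.theta ≤ RingHom.ker (hD.theta.comp (WittSeries.map g)) := by
    rw [hB.ker_theta hξ hBξ]
    exact (Ideal.span_singleton_le_iff_mem _).2 hDξ
  let f := RingHom.liftOfSurjective hB.theta hB.theta_surjective ⟨_, hker⟩
  have hf (w : WittSeries p R) : f (hB.theta w) = hD.theta (WittSeries.map g w) :=
    RingHom.liftOfSurjective_comp_apply ..
  refine ⟨f, ?_, fun b => ?_⟩
  · rw [← hB.theta_X, hf, WittSeries.map_X, hD.theta_X]
  · obtain ⟨w, rfl⟩ := hB.theta_surjective b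
    rw [hf, hD.map_theta, WittSeries.residue_map, hB.map_theta]

theorem exists_lift_over (hB : IsPerfectLift p t q) (hD : IsPerfectLift p t' q')
    (hE : IsPerfectLift p t'' q'') {i : B →+* D} {j : B →+* E} {g : R →+* S} {g' : S →+* T}
    (hi : IsLiftHom t q t' q' i g) (hj : IsLiftHom t q t'' q'' j (g'.comp g)) :
    ∃ f : D →+* E, IsLiftHom t' q' t'' q'' f g' := by
  obtain ⟨ξ, hξ, hξ₀⟩ := hB.exists_theta_eq_zero
  refine hD.exists_lift hE g' (ξ := WittSeries.map g ξ) ?_ ?_ ?_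
  · rw [WittSeries.constantCoeff_map, hξ, map_natCast]
  · rw [← hB.map_theta_eq_theta_map hD hi, hξ₀, map_zero]
  · rw [WittSeries.map_map, ← hB.map_theta_eq_theta_map hE hj, hξ₀, map_zero]

theorem exists_baseChange (hB : IsPerfectLift p t q) (hS : IsPerfectAlg p S) (g : R →+* S) :
    ∃ (ξ : WittSeries p S) (hξ : constantCoeff ξ = p) (f : B →+* WittQuotient ξ),
      IsLiftHom t q (Ideal.Quotient.mk _ X) (WittQuotient.residue hS hξ) f g := by
  obtain ⟨ξ, hξ, hξ₀⟩ := hB.exists_theta_eq_zero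
  have hgξ : constantCoeff (WittSeries.map g ξ) = p := by
    rw [WittSeries.constantCoeff_map, hξ, map_natCast]
  exact ⟨_, hgξ, hB.exists_lift (WittQuotient.isPerfectLift hS hgξ) g hξ hξ₀
    (WittQuotient.theta_self hS hgξ)⟩

end IsPerfectLift

end Construction

section FreePerfectAlg

variable {p : ℕ} [Fact p.Prime]

theorem IsPerfectAlg.isReduced {R : Type*} [CommRing R] (hR : IsPerfectAlg p R) : IsReduced R :=
  have hp : p.Prime := Fact.out
  (isReduced_iff_pow_one_lt p hp.one_lt).2 fun _ hx =>
    hR.bijective_frobenius.1 (hx.trans (zero_pow hp.ne_zero).symm)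

theorem IsPerfectAlg.quotient {R : Type*} [CommRing R] (hR : IsPerfectAlg p R) {I : Ideal R}
    (hI : I.IsRadical) : IsPerfectAlg p (R ⧸ I) where
  cast_eq_zero := by
    rw [← map_natCast (Ideal.Quotient.mk I), hR.cast_eq_zero, map_zero]
  bijective_frobenius := by
    constructor
    · intro x y hxy
      obtain ⟨a, rfl⟩ := Ideal.Quotient.mk_surjective x
      obtain ⟨b, rfl⟩ := Ideal.Quotient.mk_surjective y
      obtain _ | ⟨_, _⟩ := hR.subsingleton_or_charP
      · rw [Subsingleton.elim a b]
      · refine Ideal.Quotient.eq.2 (hI ⟨p, ?_⟩)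
        rw [sub_pow_char]
        exact Ideal.Quotient.eq.1 (by simpa only [map_pow] using hxy)
    · intro x
      obtain ⟨a, rfl⟩ := Ideal.Quotient.mk_surjective x
      obtain ⟨b, rfl⟩ := hR.bijective_frobenius.2 a
      exact ⟨Ideal.Quotient.mk I b, (map_pow _ b p).symm⟩

variable (p) in
/-- The free perfect `𝔽_p`-algebra on a type of variables. -/
abbrev FreePerfectAlg (σ : Type*) := PerfectClosure (MvPolynomial σ (ZMod p)) p

namespace FreePerfectAlg

variable {σ R : Type*} [CommRing R]

variable (p σ) in
theorem isPerfectAlg : IsPerfectAlg p (FreePerfectAlg p σ) :=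
  ⟨CharP.cast_eq_zero _ p, PerfectRing.bijective_frobenius⟩

variable (p) in
/-- The variables of the free perfect `𝔽_p`-algebra. -/
noncomputable def var (i : σ) : FreePerfectAlg p σ :=
  PerfectClosure.of _ p (MvPolynomial.X i)

theorem exists_hom (hR : IsPerfectAlg p R) (c : σ → R) :
    ∃ g : FreePerfectAlg p σ →+* R, ∀ i, g (var p i) = c i := by
  obtain _ | ⟨_, _⟩ := hR.subsingleton_or_charP
  · exact ⟨⟨⟨⟨fun _ => 0, Subsingleton.elim _ _⟩, fun _ _ => Subsingleton.elim _ _⟩,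
      Subsingleton.elim _ _, fun _ _ => Subsingleton.elim _ _⟩, fun _ => Subsingleton.elim _ _⟩
  · let g₀ : MvPolynomial σ (ZMod p) →+* R := MvPolynomial.eval₂Hom (ZMod.castHom dvd_rfl R) c
    have hg₀ : (PerfectClosure.lift _ p R g₀).comp (PerfectClosure.of _ p) = g₀ :=
      (PerfectClosure.lift _ p R).symm_apply_apply g₀
    exact ⟨PerfectClosure.lift _ p R g₀, fun i =>
      (RingHom.congr_fun hg₀ (MvPolynomial.X i)).trans (MvPolynomial.eval₂Hom_X' ..)⟩

theorem hom_ext (hR : IsPerfectAlg p R) {f g : FreePerfectAlg p σ →+* R}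
    (h : ∀ i, f (var p i) = g (var p i)) : f = g := by
  obtain _ | ⟨_, _⟩ := hR.subsingleton_or_charP
  · exact RingHom.ext fun _ => Subsingleton.elim _ _
  · exact (PerfectClosure.lift _ p R).symm.injective
      (MvPolynomial.ringHom_ext' (Subsingleton.elim _ _) h)

end FreePerfectAlg

end FreePerfectAlg

section Universal

variable {p : ℕ} [Fact p.Prime]

theorem IsPerfectLift.exists_quotient {B : Type*} {R : Type v} [CommRing B] [CommRing R] {t : B}
    {q : B →+* R} (hB : IsPerfectLift p t q) (s : Set B) :
    ∃ (U S : Type v) (_ : CommRing U) (_ : CommRing S) (r : U →+* S) (π : B →+* U),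
      IsPerfectLift p (π t) r ∧ Function.Surjective π ∧ (∀ x ∈ s, π x = 0) ∧
      ∀ (D T : Type w) [CommRing D] [CommRing T] (q' : D →+* T) (f : B →+* D),
        IsPerfectLift p (f t) q' → (∀ x ∈ s, f x = 0) → ∃ f' : U →+* D, f'.comp π = f := by
  let I : Ideal R := (Ideal.span {r | ∃ x ∈ s, ∃ i, hB.digits x i = r}).radical
  have hI : IsPerfectAlg p (R ⧸ I) := hB.perfect.quotient (Ideal.radical_isRadical _)
  obtain ⟨ξ, hξ, π, hπ⟩ := hB.exists_baseChange hI (Ideal.Quotient.mk I)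
  have hU := WittQuotient.isPerfectLift hI hξ
  refine ⟨WittQuotient ξ, R ⧸ I, inferInstance, inferInstance, WittQuotient.residue hI hξ, π,
    hπ.map_uniformizer ▸ hU, hB.surjective_of_surjective hU hπ Ideal.Quotient.mk_surjective,
    fun x hx => ?_, fun D T _ _ q' f hD hf => ?_⟩
  · rw [hB.map_eq_zero_iff_digits hU hπ]
    exact fun i => Ideal.Quotient.eq_zero_iff_mem.2
      (Ideal.le_radical (Ideal.subset_span ⟨x, hx, i, rfl⟩))
  · obtain ⟨g, hg⟩ := hB.exists_reduction hD rfl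
    have := hD.perfect.isReduced
    have hker : I ≤ RingHom.ker g := by
      refine (Ideal.isRadical_bot.comap g).radical_le_iff.2 (Ideal.span_le.2 ?_)
      rintro _ ⟨x, hx, i, rfl⟩
      exact (hB.map_eq_zero_iff_digits hD hg).1 (hf x hx) i
    have hfactor : (Ideal.Quotient.lift I g hker).comp (Ideal.Quotient.mk I) = g :=
      Ideal.Quotient.lift_comp_mk I g hker
    obtain ⟨f', hf'⟩ := hB.exists_lift_over hU hD hπ (hfactor.symm ▸ hg)
    exact ⟨f', hB.hom_ext hD (hf'.comp hπ) (hfactor.symm ▸ hg)⟩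

/-- The generic series `p - ∑ i, [x i] X ^ (i + 1)`, where the `x i` are the variables with index
`(none, i)` of a free perfect algebra. The other variables are left over for the generators of
`FreePerfectLift`. -/
noncomputable def genericRelation (p : ℕ) [Fact p.Prime] (σ : Type*) :
    WittSeries p (FreePerfectAlg p (Option σ × ℕ)) :=
  (p : WittSeries p _) - X * WittSeries.teichmuller p fun i => FreePerfectAlg.var p (none, i)

/-- The universal ring generated by elements indexed by `σ` among the lifts of perfect
`𝔽_p`-algebras. -/
abbrev FreePerfectLift (p : ℕ) [Fact p.Prime] (σ : Type*) := WittQuotient (genericRelation p σ)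

namespace FreePerfectLift

variable {σ D S : Type*} [CommRing D] [CommRing S] {t' : D} {q' : D →+* S}

theorem constantCoeff_genericRelation : constantCoeff (genericRelation p σ) = p := by
  rw [genericRelation, map_sub, map_natCast, map_mul, constantCoeff_X, zero_mul, sub_zero]

variable (p σ) in
/-- The uniformizer of the free lift. -/
noncomputable def uniformizer : FreePerfectLift p σ := Ideal.Quotient.mk _ X

variable (p σ) in
/-- The residue map of the free lift. -/
noncomputable def residue : FreePerfectLift p σ →+* FreePerfectAlg p (Option σ × ℕ) :=
  WittQuotient.residue (FreePerfectAlg.isPerfectAlg p _) constantCoeff_genericRelation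

variable (p σ) in
theorem isPerfectLift : IsPerfectLift p (uniformizer p σ) (residue p σ) :=
  WittQuotient.isPerfectLift _ _

variable (p) in
/-- The generators of the free lift, together with the quotient of `p` by the uniformizer, which has
index `none`. -/
noncomputable def gen (i : Option σ) : FreePerfectLift p σ :=
  (isPerfectLift p σ).expansion fun n => FreePerfectAlg.var p (i, n)

theorem uniformizer_mul_gen_none :
    uniformizer p σ * gen p none = (p : FreePerfectLift p σ) := by
  have h : (isPerfectLift p σ).theta ((p : WittSeries p _) -
      X * WittSeries.teichmuller p fun i => FreePerfectAlg.var p (none, i)) = 0 :=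
    WittQuotient.theta_self _ _
  rw [map_sub, map_natCast, map_mul, IsPerfectLift.theta_X] at h
  exact (sub_eq_zero.1 h).symm

theorem exists_hom (hD : IsPerfectLift p t' q') (c : σ → D) :
    ∃ f : FreePerfectLift p σ →+* D, f (uniformizer p σ) = t' ∧ ∀ i, f (gen p (some i)) = c i := by
  obtain ⟨c₀, hc₀⟩ := hD.dvd_natCast
  obtain ⟨g, hg⟩ := FreePerfectAlg.exists_hom hD.perfect fun i : Option σ × ℕ =>
    hD.digits (i.1.elim c₀ c) i.2
  have hgξ : hD.theta (WittSeries.map g (genericRelation p σ)) = 0 := by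
    rw [genericRelation, map_sub, map_sub, map_natCast, map_natCast, map_mul, map_mul,
      WittSeries.map_X, WittSeries.map_teichmuller, hD.theta_X, hc₀, sub_eq_zero,
      ← hD.expansion_digits c₀]
    exact congrArg (t' * hD.expansion ·) (funext fun i => (hg (none, i)).symm)
  obtain ⟨f, hf⟩ := (isPerfectLift p σ).exists_lift hD g constantCoeff_genericRelation
    (WittQuotient.theta_self _ _) hgξ
  refine ⟨f, hf.map_uniformizer, fun i => ?_⟩
  rw [gen, (isPerfectLift p σ).map_expansion_eq_expansion_comp hD hf, ← hD.expansion_digits (c i)]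
  exact congrArg _ (funext fun n => hg (some i, n))

theorem hom_ext (hD : IsPerfectLift p t' q') {f f' : FreePerfectLift p σ →+* D}
    (hf : f (uniformizer p σ) = t') (hf' : f' (uniformizer p σ) = t')
    (h : ∀ i, f (gen p (some i)) = f' (gen p (some i))) : f = f' := by
  have hF := isPerfectLift p σ
  have hgen : ∀ i, f (gen p i) = f' (gen p i)
    | some i => h i
    | none => by
      rw [← mul_cancel_left_mem_nonZeroDivisors hD.mem_nonZeroDivisors]
      nth_rewrite 1 [← hf]
      rw [← hf', ← map_mul, ← map_mul, uniformizer_mul_gen_none, map_natCast, map_natCast]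
  obtain ⟨g, hg⟩ := hF.exists_reduction hD hf
  obtain ⟨g', hg'⟩ := hF.exists_reduction hD hf'
  have hgg' : g = g' := by
    refine FreePerfectAlg.hom_ext hD.perfect fun ⟨i, n⟩ => ?_
    have hi := hgen i
    rw [gen, hF.map_expansion_eq_expansion_comp hD hg,
      hF.map_expansion_eq_expansion_comp hD hg'] at hi
    exact congrFun (hD.expansion_injective hi) n
  exact hF.hom_ext hD hg (hgg' ▸ hg')

end FreePerfectLift

theorem exists_universal_isPerfectLift (A : Type u) [CommRing A] (ϖ : A) :
    ∃ (U S : Type u) (_ : CommRing U) (_ : CommRing S) (q : U →+* S) (φ : A →+* U),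
      IsPerfectLift p (φ ϖ) q ∧
      ∀ (B R : Type w) [CommRing B] [CommRing R] (q' : B →+* R) (ψ : A →+* B),
        IsPerfectLift p (ψ ϖ) q' → ∃! f : U →+* B, f.comp φ = ψ := by
  let t := FreePerfectLift.uniformizer p A
  let gen (a : A) := FreePerfectLift.gen p (some a)
  let eval : MvPolynomial A ℤ →+* A := MvPolynomial.eval₂Hom (Int.castRingHom A) id
  let evalGen : MvPolynomial A ℤ →+* FreePerfectLift p A :=
    MvPolynomial.eval₂Hom (Int.castRingHom _) gen
  have heval (a : A) : eval (MvPolynomial.X a) = a := MvPolynomial.eval₂Hom_X' ..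
  have hevalGen (a : A) : evalGen (MvPolynomial.X a) = gen a := MvPolynomial.eval₂Hom_X' ..
  have eval_surjective : Function.Surjective eval := fun a => ⟨_, heval a⟩
  obtain ⟨U, S, _, _, q, π, hU, hπ, hπ₀, hlift⟩ :=
    (FreePerfectLift.isPerfectLift p A).exists_quotient
      (insert (gen ϖ - t) (evalGen '' RingHom.ker eval))
  have hker : RingHom.ker eval ≤ RingHom.ker (π.comp evalGen) := fun x hx =>
    hπ₀ _ (.inr ⟨x, hx, rfl⟩)
  let φ : A →+* U := RingHom.liftOfSurjective eval eval_surjective ⟨_, hker⟩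
  have hφ (a : A) : φ a = π (gen a) := by
    rw [← hevalGen, ← congrArg φ (heval a)]
    exact RingHom.liftOfSurjective_comp_apply ..
  have hφϖ : φ ϖ = π t := by
    rw [hφ, ← sub_eq_zero, ← map_sub]
    exact hπ₀ _ (.inl rfl)
  refine ⟨U, S, _, _, q, φ, hφϖ ▸ hU, fun B R _ _ q' ψ hB =>
    existsUnique_of_exists_of_unique ?_ fun f f' hf hf' => ?_⟩
  · obtain ⟨f, hft, hf⟩ := FreePerfectLift.exists_hom hB ψ
    have hfeval : f.comp evalGen = ψ.comp eval :=
      MvPolynomial.ringHom_ext' (Subsingleton.elim _ _) fun a => by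
        rw [RingHom.comp_apply, RingHom.comp_apply, hevalGen, heval, hf]
    obtain ⟨f', rfl⟩ := hlift B R q' f (hft.symm ▸ hB) (by
      rintro _ (rfl | ⟨x, hx, rfl⟩)
      · rw [map_sub, hf, hft, sub_self]
      · rw [← RingHom.comp_apply, hfeval, RingHom.comp_apply, RingHom.mem_ker.1 hx, map_zero])
    exact ⟨f', RingHom.ext fun a => (congrArg f' (hφ a)).trans (hf a)⟩
  · have hφ_apply {k : U →+* B} (hk : k.comp φ = ψ) (a : A) : k (φ a) = ψ a :=
      RingHom.congr_fun hk a
    refine (RingHom.cancel_right hπ).1 (FreePerfectLift.hom_ext hB ?_ ?_ fun a => ?_)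
    · exact (congrArg f hφϖ).symm.trans (hφ_apply hf ϖ)
    · exact (congrArg f' hφϖ).symm.trans (hφ_apply hf' ϖ)
    · simp only [RingHom.comp_apply, gen, ← hφ, hφ_apply hf, hφ_apply hf']

end Universal

section CRP

theorem IsPerfectAlg.of_ringEquiv {p : ℕ} {R S : Type*} [CommRing R] [CommRing S]
    (hR : IsPerfectAlg p R) (e : S ≃+* R) : IsPerfectAlg p S where
  cast_eq_zero := e.injective (by rw [map_natCast, map_zero, hR.cast_eq_zero])
  bijective_frobenius := by
    have hconj : (fun x : S => x ^ p) = e.symm ∘ (fun x : R => x ^ p) ∘ e :=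
      funext fun x => (e.symm_apply_eq.2 (map_pow e x p).symm).symm
    rw [hconj]
    exact e.symm.bijective.comp (hR.bijective_frobenius.comp e.bijective)

variable {p : ℕ} {A : Type u} [CommRing A] [IsDomain A] [IsDiscreteValuationRing A]
  {B D U : Type u} [CommRing B] [Algebra A B] [CommRing D] [Algebra A D] [CommRing U] [Algebra A U]
  {ϖ : A}

theorem flat_of_algebraMap_mem_nonZeroDivisors (hϖ : Irreducible ϖ)
    (h : algebraMap A B ϖ ∈ nonZeroDivisors B) : Module.Flat A B := by
  have : Module.IsTorsionFree A B := ⟨fun r hr x y hxy => by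
    obtain ⟨n, v, rfl⟩ := IsDiscreteValuationRing.eq_unit_mul_pow_irreducible hr.ne_zero hϖ
    have hmem : algebraMap A B (v * ϖ ^ n) ∈ nonZeroDivisors B := by
      rw [map_mul, map_pow]
      exact mul_mem (v.isUnit.map _).mem_nonZeroDivisors (pow_mem h n)
    exact (mul_cancel_left_mem_nonZeroDivisors hmem).1
      (by simpa only [Algebra.smul_def] using hxy)⟩
  infer_instance

variable (B) in
theorem extIdeal_eq_span (hϖ : Irreducible ϖ) : extIdeal A B = Ideal.span {algebraMap A B ϖ} := by
  rw [extIdeal, hϖ.maximalIdeal_eq, Ideal.map_span, Set.image_singleton]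

theorem IsCompleteResidualPerfection.isPerfectLift (h : IsCompleteResidualPerfection A p B)
    (hϖ : Irreducible ϖ) :
    IsPerfectLift p (algebraMap A B ϖ) (Ideal.Quotient.mk (extIdeal A B)) where
  mem_nonZeroDivisors := by
    have := h.flat
    rw [mem_nonZeroDivisors_iff_left]
    intro x hx
    rw [← Algebra.smul_def] at hx
    exact (smul_eq_zero.1 hx).resolve_left hϖ.ne_zero
  isAdicComplete := extIdeal_eq_span B hϖ ▸ h.complete
  surjective := Ideal.Quotient.mk_surjective
  ker_eq := by rw [Ideal.mk_ker, extIdeal_eq_span B hϖ]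
  perfect := h.perfect

theorem isLiftHom_reductionMap (f : B →ₐ[A] D) (ϖ : A) :
    IsLiftHom (algebraMap A B ϖ) (Ideal.Quotient.mk (extIdeal A B)) (algebraMap A D ϖ)
      (Ideal.Quotient.mk (extIdeal A D)) (f : B →+* D) (reductionMap f) :=
  ⟨f.commutes ϖ, fun _ => rfl⟩

namespace IsPerfectLift

variable {R : Type*} [CommRing R] {q : B →+* R}

/-- The identification of the reduction of a lift with its residue ring. -/
noncomputable def reductionEquiv (h : IsPerfectLift p (algebraMap A B ϖ) q) (hϖ : Irreducible ϖ) :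
    Reduction A B ≃+* R :=
  (Ideal.quotEquivOfEq ((extIdeal_eq_span B hϖ).trans h.ker_eq.symm)).trans
    (RingHom.quotientKerEquivOfSurjective h.surjective)

theorem isCompleteResidualPerfection (h : IsPerfectLift p (algebraMap A B ϖ) q)
    (hϖ : Irreducible ϖ) : IsCompleteResidualPerfection A p B where
  flat := flat_of_algebraMap_mem_nonZeroDivisors hϖ h.mem_nonZeroDivisors
  complete := (extIdeal_eq_span B hϖ).symm ▸ h.isAdicComplete
  perfect := h.perfect.of_ringEquiv (h.reductionEquiv hϖ)

end IsPerfectLift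

theorem algHom_ext_of_reductionMap (hB : IsCompleteResidualPerfection A p B)
    (hD : IsCompleteResidualPerfection A p D) {f g : B →ₐ[A] D}
    (h : reductionMap f = reductionMap g) : f = g := by
  obtain ⟨ϖ, hϖ⟩ := IsDiscreteValuationRing.exists_irreducible A
  exact AlgHom.coe_ringHom_injective ((hB.isPerfectLift hϖ).hom_ext (hD.isPerfectLift hϖ)
    (isLiftHom_reductionMap f ϖ) (h ▸ isLiftHom_reductionMap g ϖ))

variable [Fact p.Prime]

theorem exists_algHom_reductionMap_eq (hU : IsCompleteResidualPerfection A p U)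
    (hB : IsCompleteResidualPerfection A p B) (hD : IsCompleteResidualPerfection A p D)
    (i : U →ₐ[A] B) (j : U →ₐ[A] D) (g : Reduction A B →+* Reduction A D)
    (hg : g.comp (reductionMap i) = reductionMap j) : ∃ f : B →ₐ[A] D, reductionMap f = g := by
  obtain ⟨ϖ, hϖ⟩ := IsDiscreteValuationRing.exists_irreducible A
  have hi := isLiftHom_reductionMap i ϖ
  have hj := isLiftHom_reductionMap j ϖ
  rw [← hg] at hj
  obtain ⟨f, hf⟩ := (hU.isPerfectLift hϖ).exists_lift_over (hB.isPerfectLift hϖ)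
    (hD.isPerfectLift hϖ) hi hj
  have hfi : f.comp (i : U →+* B) = j :=
    (hU.isPerfectLift hϖ).hom_ext (hD.isPerfectLift hϖ) (hf.comp hi) hj
  have hcomm (a : A) : f (algebraMap A B a) = algebraMap A D a := by
    rw [← i.commutes, ← j.commutes]
    exact RingHom.congr_fun hfi _
  exact ⟨{ f with commutes' := hcomm }, Ideal.Quotient.ringHom_ext (RingHom.ext hf.map_residue)⟩

theorem exists_lift_of_reduction (hU : IsCompleteResidualPerfection A p U) {R : Type u}
    [CommRing R] (hR : IsPerfectAlg p R) (g : Reduction A U →+* R) :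
    ∃ (B : Type u) (_ : CommRing B) (_ : Algebra A B) (_ : IsCompleteResidualPerfection A p B)
      (f : U →ₐ[A] B) (e : Reduction A B ≃+* R), ∀ r, e (reductionMap f r) = g r := by
  obtain ⟨ϖ, hϖ⟩ := IsDiscreteValuationRing.exists_irreducible A
  obtain ⟨ξ, hξ, f, hf⟩ := (hU.isPerfectLift hϖ).exists_baseChange hR g
  have hB := WittQuotient.isPerfectLift hR hξ
  let : Algebra A (WittQuotient ξ) := (f.comp (algebraMap A U)).toAlgebra
  rw [← hf.map_uniformizer] at hB
  refine ⟨_, inferInstance, inferInstance, hB.isCompleteResidualPerfection hϖ,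
    { f with commutes' := fun _ => rfl }, hB.reductionEquiv hϖ, fun r => ?_⟩
  obtain ⟨b, rfl⟩ := Ideal.Quotient.mk_surjective r
  exact hf.map_residue b

variable (p A) in
theorem exists_isInitial : ∃ U : CRP A p, Nonempty (Limits.IsInitial U) := by
  obtain ⟨ϖ, hϖ⟩ := IsDiscreteValuationRing.exists_irreducible A
  obtain ⟨U, S, _, _, q, φ, hU, huniv⟩ := exists_universal_isPerfectLift (p := p) A ϖ
  let : Algebra A U := φ.toAlgebra
  choose f hf huniq using fun B : CRP A p =>
    huniv B.obj _ _ (algebraMap A B.obj) (B.property.isPerfectLift hϖ)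
  refine ⟨⟨CommAlgCat.of A U, IsPerfectLift.isCompleteResidualPerfection hU hϖ⟩,
    ⟨Limits.IsInitial.ofUniqueHom (fun B => ObjectProperty.homMk (CommAlgCat.ofHom
      { f B with commutes' := RingHom.congr_fun (hf B) })) fun B m => ?_⟩⟩
  apply ObjectProperty.hom_ext
  apply CommAlgCat.hom_ext
  exact AlgHom.ext (RingHom.congr_fun
    (huniq B (m.hom.hom : U →+* B.obj) (RingHom.ext m.hom.hom.commutes)))

theorem reductionFunctor_isEquivalence (U : CRP A p) (hU : Limits.IsInitial U) :
    (reductionFunctor U hU).IsEquivalence where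
  faithful := ⟨fun {B D f g} h => by
    apply ObjectProperty.hom_ext
    apply CommAlgCat.hom_ext
    refine algHom_ext_of_reductionMap B.property D.property (RingHom.ext fun x => ?_)
    exact congrArg (fun k : (reductionFunctor U hU).obj B ⟶ (reductionFunctor U hU).obj D =>
      k.hom.hom x) h⟩
  full := ⟨fun {B D} g => by
    obtain ⟨f, hf⟩ := exists_algHom_reductionMap_eq U.property B.property D.property
      (hU.to B).hom.hom (hU.to D).hom.hom g.hom.hom.toRingHom (RingHom.ext g.hom.hom.commutes)
    refine ⟨ObjectProperty.homMk (CommAlgCat.ofHom f), ?_⟩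
    apply ObjectProperty.hom_ext
    apply CommAlgCat.hom_ext
    exact AlgHom.ext (RingHom.congr_fun hf)⟩
  essSurj := ⟨fun R => by
    obtain ⟨B, _, _, hB, f, e, he⟩ := exists_lift_of_reduction U.property R.property
      (algebraMap (Reduction A U.obj) R.obj)
    let B' : CRP A p := ⟨CommAlgCat.of A B, hB⟩
    have hf : (hU.to B').hom.hom = f := congrArg (fun k : U ⟶ B' => k.hom.hom)
      (hU.hom_ext _ (ObjectProperty.homMk (CommAlgCat.ofHom f)))
    let := (reductionMap (hU.to B').hom.hom).toAlgebra
    let e' : Reduction A B ≃ₐ[Reduction A U.obj] R.obj := AlgEquiv.ofRingEquiv (f := e) fun r =>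
      (congrArg (fun k => e (reductionMap k r)) hf).trans (he r)
    exact ⟨B', ⟨ObjectProperty.isoMk _ (CommAlgCat.isoMk e')⟩⟩⟩

end CRP

end ResidualPerfection

theorem mainTheorem1 (p : ℕ) [Fact p.Prime] (A : Type u) [CommRing A] [IsDomain A]
    [IsDiscreteValuationRing A] [CharP (IsLocalRing.ResidueField A) p] :
    (∃ U : ResidualPerfection.CRP A p, Nonempty (Limits.IsInitial U)) ∧
      ∀ (U : ResidualPerfection.CRP A p) (hU : Limits.IsInitial U),
        (ResidualPerfection.reductionFunctor U hU).IsEquivalence :=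
  ⟨ResidualPerfection.exists_isInitial p A, ResidualPerfection.reductionFunctor_isEquivalence⟩
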